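/- Fix integers $h\ge 1$ and $m_1,\dots,m_h\ge 1$, put $m=m_1+\cdots+m_h$, and fix a real $\alpha\ge 0$. For $n>m$ consider a library of items $1,\dots,n$ with the Zipf($\alpha$) popularity law $p_i=A_n/i^{\alpha}$, where $A_n$ is the constant with $\sum_{i=1}^n p_i=1$. The policy LRU($\boldsymbol m$), $\boldsymbol m=(m_1,\dots,m_h)$, manages a linear network of caches $1,\dots,h$ of sizes $m_1,\dots,m_h$. A state places $m$ distinct items in the positions $(i,j)$, $1\le i\le h$, $1\le j\le m_i$. When an item $k$ is requested: - if $k$ is in no cache, it is inserted in the first position of cache $1$, all other items of cache $1$ move back one position, and the last item of cache $1$ is evicted; - if $k$ is in position $j$ of a cache $i<h$, it moves to the first position of cache $i+1$, all other items of cache $i+1$ move back one position, the item that was last in cache $i+1$ moves to the first position of cache $i$, and the items that were in positions $1,\dots,j-1$ of cache $i$ move back one position; - if $k$ is in position $j$ of cache $h$, it moves to the first position of cache $h$, and the items that were in positions $1,\dots,j-1$ of cache $h$ move back one position. Successive requests are independent, each being for item $k$ with probability $p_k$; this gives a Markov chain on the states, one step per request, with transition matrix $P_n$. Let $\pi_n^*$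 be its stationary distribution and let $t_{\mathrm{mix}}^{\mathrm{LRU}(\boldsymbol m)}(n)$ be the smallest $t\ge 0$ with $\max_{\boldsymbol x}\|P_n^t(\boldsymbol x,\cdot)-\pi_n^*\|_{TV}\le \tfrac12$, where $\|\mu-\nu\|_{TV}=\tfrac12\sum_{\boldsymbol x}|\mu(\boldsymbol x)-\nu(\boldsymbol x)|$. Then, for all sufficiently large $n$, the stationary distribution $\pi_n^*$ exists and is unique and the mixing time is finite, and, as $n\to\infty$, $$t_{\mathrm{mix}}^{\mathrm{LRU}(\boldsymbol m)}(n)=O\!\left(n^{(4m+4\alpha-6)(m_1+2m_2+\cdots+hm_h)+6}\,\ln n\right),$$ where the implied constant may depend on $h$, $m_1,\dots,m_h$ and $\alpha$ but not on $n$. -/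

import Mathlib

open Filter Asymptotics

/-- The slots of a linear network of `h` caches, the `i`-th of size `m i`. Indices start at `0`:
`⟨i, j⟩` is position `j + 1` of cache `i + 1`. -/
abbrev Slot {h : ℕ} (m : Fin h → ℕ+) : Type := Σ i : Fin h, Fin (m i : ℕ)

/-- A state of the network: every slot holds one of the `n` items, and no item is held twice. -/
abbrev CacheState {h : ℕ} (m : Fin h → ℕ+) (n : ℕ) : Type := Slot m ↪ Fin n

noncomputable instance {h : ℕ} (m : Fin h → ℕ+) (n : ℕ) : DecidableEq (CacheState m n) :=
  Classical.decEq _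

/-- The slot one position closer to the front of the same cache (used only away from the front). -/
def Slot.prev {h : ℕ} {m : Fin h → ℕ+} (q : Slot m) : Slot m :=
  ⟨q.1, ⟨q.2.val - 1, by have := q.2.isLt; omega⟩⟩

/-- The last slot of a cache. -/
def Slot.last {h : ℕ} (m : Fin h → ℕ+) (i : Fin h) : Slot m :=
  ⟨i, ⟨(m i : ℕ) - 1, by have := (m i).pos; omega⟩⟩

/-- Update after a hit on the item in slot `s`: slot `q` receives the item that was in
`hitSource s q`. The requested item goes to the front of the next cache, whose other items move
back one position; the last item of that next cache goes to the front of the cache of `s`, where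
the items that were in front of `s` move back one position. If the cache of `s` is the last one,
the requested item itself goes to the front of that cache. -/
def hitSource {h : ℕ} {m : Fin h → ℕ+} (s q : Slot m) : Slot m :=
  if q.1.val = s.1.val + 1 then
    if q.2.val = 0 then s else q.prev
  else if q.1.val = s.1.val then
    if q.2.val = 0 then
      if hs : s.1.val + 1 < h then Slot.last m ⟨s.1.val + 1, hs⟩ else s
    else if q.2.val ≤ s.2.val then q.prev
    else q
  else q

theorem Slot.ext_val {h : ℕ} {m : Fin h → ℕ+} {q r : Slot m} (h1 : q.1.val = r.1.val)
    (h2 : q.2.val = r.2.val) : q = r := by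
  obtain ⟨a, b⟩ := q
  obtain ⟨c, d⟩ := r
  obtain rfl : a = c := Fin.ext h1
  obtain rfl : b = d := Fin.ext h2
  rfl

theorem hitSource_injective {h : ℕ} {m : Fin h → ℕ+} (s : Slot m) :
    Function.Injective (hitSource s) := by
  intro q r hqr
  have h1 := congrArg (fun z : Slot m => z.1.val) hqr
  have h2 := congrArg (fun z : Slot m => z.2.val) hqr
  have key : ∀ (a : Slot m) (hs : s.1.val + 1 < h), a.1.val = s.1.val + 1 →
      a.2.val < (m ⟨s.1.val + 1, hs⟩ : ℕ) := by
    intro a hs ha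
    have hlt := a.2.isLt
    have e : a.1 = ⟨s.1.val + 1, hs⟩ := Fin.ext ha
    exact lt_of_lt_of_eq hlt (congrArg (fun c => (m c : ℕ)) e)
  have kq := key q
  have kr := key r
  apply Slot.ext_val
  · revert h1 h2
    simp only [hitSource]
    split_ifs <;> simp only [Slot.prev, Slot.last] <;> intro h1 h2 <;> grind
  · revert h1 h2
    simp only [hitSource]
    split_ifs <;> simp only [Slot.prev, Slot.last] <;> intro h1 h2 <;> grind

/-- The state after a hit on the item in slot `s`. -/
def hitState {h : ℕ} {m : Fin h → ℕ+} {n : ℕ} (x : CacheState m n) (s : Slot m) :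
    CacheState m n :=
  ⟨fun q => x (hitSource s q), x.injective.comp (hitSource_injective s)⟩

/-- The contents after a miss on item `k`: `k` goes to the front of the first cache, the other
items of that cache move back one position, and the last one is evicted. -/
def missFun {h : ℕ} {m : Fin h → ℕ+} {n : ℕ} (x : CacheState m n) (k : Fin n) (q : Slot m) :
    Fin n :=
  if q.1.val = 0 then
    if q.2.val = 0 then k else x q.prev
  else x q

theorem missFun_injective {h : ℕ} {m : Fin h → ℕ+} {n : ℕ} (x : CacheState m n) (k : Fin n)
    (hk : ¬ ∃ s, x s = k) : Function.Injective (missFun x k) := by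
  have hk' : ∀ s, x s ≠ k := fun s hs => hk ⟨s, hs⟩
  intro q r hqr
  simp only [missFun] at hqr
  split_ifs at hqr with a b c d e f g
  all_goals first
    | exact absurd hqr (hk' _)
    | exact absurd hqr.symm (hk' _)
    | exact x.injective hqr
    | exact Slot.ext_val (by omega) (by omega)
    | (have h3 := x.injective hqr
       have h1 := congrArg (fun z : Slot m => z.1.val) h3
       have h2 := congrArg (fun z : Slot m => z.2.val) h3
       simp only [Slot.prev] at h1 h2
       exact Slot.ext_val (by omega) (by omega))

open Classical in
/-- One step of the LRU(m) policy: the state after a request for item `k` in state `x`. -/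
noncomputable def lruStep {h : ℕ} {m : Fin h → ℕ+} {n : ℕ} (x : CacheState m n) (k : Fin n) :
    CacheState m n :=
  if hk : ∃ s, x s = k then hitState x hk.choose
  else ⟨missFun x k, missFun_injective x k hk⟩

/-- The transition matrix of the LRU(m) chain when successive requests are independent, each being
for item `k` with probability `p k`. One step of the chain is one request. -/
noncomputable def lruMatrix {h : ℕ} (m : Fin h → ℕ+) {n : ℕ} (p : Fin n → ℝ) :
    Matrix (CacheState m n) (CacheState m n) ℝ :=
  Matrix.of fun x y => ∑ k : Fin n, if lruStep x k = y then p k else 0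

/-- The Zipf(α) popularity law on `n` items: the `i`-th most popular item (`i = 1, …, n`, stored as
the index `i - 1`) has probability `A / i ^ α`, where `A` makes the total equal to `1`. -/
noncomputable def zipf (n : ℕ) (α : ℝ) (i : Fin n) : ℝ :=
  (∑ j : Fin n, 1 / ((j.val : ℝ) + 1) ^ α)⁻¹ / ((i.val : ℝ) + 1) ^ α

/-- `π` is a stationary probability distribution of the transition matrix `P`. -/
def IsStationaryDist {S : Type*} [Fintype S] (P : Matrix S S ℝ) (π : S → ℝ) : Prop :=
  π ∈ stdSimplex ℝ S ∧ Matrix.vecMul π P = π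

/-- The total variation distance between two probability distributions on a finite set. -/
noncomputable def tvDist {S : Type*} [Fintype S] (μ ν : S → ℝ) : ℝ :=
  (1 / 2) * ∑ x, |μ x - ν x|

/-- The times `t` at which the chain, from every starting state, is within `ε` of `π`. -/
def mixedTimes {S : Type*} [Fintype S] [DecidableEq S] (P : Matrix S S ℝ) (π : S → ℝ) (ε : ℝ) :
    Set ℕ :=
  {t | ∀ x, tvDist (fun y => (P ^ t) x y) π ≤ ε}

/-- The mixing time: the smallest `t` at which the chain is within `ε` of `π` from every starting
state (meaningful when `mixedTimes P π ε` is nonempty). -/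
noncomputable def mixingTime {S : Type*} [Fintype S] [DecidableEq S] (P : Matrix S S ℝ)
    (π : S → ℝ) (ε : ℝ) : ℕ :=
  sInf (mixedTimes P π ε)

/-- The total cache size `m₁ + ⋯ + m_h`. -/
def totalSize {h : ℕ} (m : Fin h → ℕ+) : ℕ := ∑ i, (m i : ℕ)

/-- The weighted size `m₁ + 2 m₂ + ⋯ + h m_h`. -/
def weightedSize {h : ℕ} (m : Fin h → ℕ+) : ℕ := ∑ i : Fin h, (i.val + 1) * (m i : ℕ)

/-! The argument is a Doeblin minorization. Requesting an item absent from all caches `i + 1` times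
carries it to the front of cache `i` and disturbs no later cache. Doing so with `m i` fresh items
overwrites cache `i`; working from the last cache back to the first, one word of `w = weightedSize
m` requests drives any two states to the same state (`exists_sync_word`).

The word uses only the `3 * totalSize m` most popular items, each of probability at least `1 / (n *
C)`, where `C = (3 * totalSize m) ^ α`. Hence any two rows of `P ^ w` have a common entry of size at
least `δ = (n * C) ^ (-w)`. This gives uniqueness of the stationary law and mixing within `2 * w / δ
= O(n ^ w)` steps (`IsStochastic.exists_mem_mixedTimes`). The claimed exponent is at least `w`
(`weightedSize_le_exponent`). -/

/-- `P` is a row-stochastic matrix. -/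
structure IsStochastic {S : Type*} [Fintype S] (P : Matrix S S ℝ) : Prop where
  nonneg : ∀ x y, 0 ≤ P x y
  sum_row : ∀ x, ∑ y, P x y = 1

/-! ### Finite stochastic matrices: stationarity and Doeblin contraction -/

section Stochastic

variable {S : Type*} [Fintype S]

theorem IsStochastic.one [DecidableEq S] : IsStochastic (1 : Matrix S S ℝ) where
  nonneg x y := by
    rw [Matrix.one_apply]
    split_ifs <;> norm_num
  sum_row x := by simp [Matrix.one_apply]

theorem IsStochastic.mul {P Q : Matrix S S ℝ} (hP : IsStochastic P) (hQ : IsStochastic Q) :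
    IsStochastic (P * Q) where
  nonneg x y := by
    rw [Matrix.mul_apply]
    exact Finset.sum_nonneg fun z _ => mul_nonneg (hP.nonneg x z) (hQ.nonneg z y)
  sum_row x := by
    simp only [Matrix.mul_apply]
    rw [Finset.sum_comm]
    simp only [← Finset.mul_sum, hQ.sum_row, mul_one, hP.sum_row]

theorem IsStochastic.pow [DecidableEq S] {P : Matrix S S ℝ} (hP : IsStochastic P) (t : ℕ) :
    IsStochastic (P ^ t) := by
  induction t with
  | zero => simpa using IsStochastic.one
  | succ t ih => rw [pow_succ]; exact ih.mul hP

theorem IsStationaryDist.pow [DecidableEq S] {P : Matrix S S ℝ} {π : S → ℝ} (hπ : IsStationaryDist P π) (t : ℕ) :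
    IsStationaryDist (P ^ t) π := by
  refine ⟨hπ.1, ?_⟩
  induction t with
  | zero => simp
  | succ t ih => rw [pow_succ, ← Matrix.vecMul_vecMul, ih, hπ.2]

/-- A stochastic matrix on a nonempty finite set has a stationary distribution. -/
theorem IsStochastic.exists_isStationaryDist [DecidableEq S] [Nonempty S] {P : Matrix S S ℝ}
    (hP : IsStochastic P) : ∃ π, IsStationaryDist P π := by
  -- The constant vector shows that `P - 1` is singular, so it also has a nonzero left null vector.
  have h1 : ∃ v : S → ℝ, v ≠ 0 ∧ Matrix.mulVec (P - 1) v = 0 := by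
    refine ⟨fun _ => 1, fun h => ?_, ?_⟩
    · obtain ⟨x⟩ := ‹Nonempty S›
      exact one_ne_zero (congrFun h x)
    · rw [Matrix.sub_mulVec, Matrix.one_mulVec, sub_eq_zero]
      ext x
      simpa [Matrix.mulVec, dotProduct] using hP.sum_row x
  obtain ⟨v, hv0, hv⟩ := Matrix.exists_vecMul_eq_zero_iff.2 (Matrix.exists_mulVec_eq_zero_iff.1 h1)
  rw [Matrix.vecMul_sub, Matrix.vecMul_one, sub_eq_zero] at hv
  -- The entrywise bound `|v| ≤ |v| P` is an equality because both sides have the same total mass;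
  -- so `|v|`, normalized, is stationary.
  have hle : ∀ y, |v y| ≤ ∑ x, |v x| * P x y := fun y => by
    calc |v y| = |∑ x, v x * P x y| := by rw [← congrFun hv y]; rfl
      _ ≤ ∑ x, |v x * P x y| := Finset.abs_sum_le_sum_abs _ _
      _ = _ := Finset.sum_congr rfl fun x _ => by rw [abs_mul, abs_of_nonneg (hP.nonneg x y)]
  have hsum : ∑ y, |v y| = ∑ y, ∑ x, |v x| * P x y := by
    rw [Finset.sum_comm]
    simp only [← Finset.mul_sum, hP.sum_row, mul_one]
  have heq := (Finset.sum_eq_sum_iff_of_le fun y _ => hle y).1 hsum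
  have hpos : 0 < ∑ y, |v y| := by
    obtain ⟨x, hx⟩ := Function.ne_iff.1 hv0
    exact Finset.sum_pos' (fun y _ => abs_nonneg _) ⟨x, Finset.mem_univ x, abs_pos.2 hx⟩
  refine ⟨(∑ y, |v y|)⁻¹ • fun y => |v y|, ⟨fun y => ?_, ?_⟩, ?_⟩
  · exact mul_nonneg (inv_nonneg.2 hpos.le) (abs_nonneg _)
  · simp only [Pi.smul_apply, smul_eq_mul, ← Finset.mul_sum]
    exact inv_mul_cancel₀ hpos.ne'
  · rw [Matrix.smul_vecMul]
    congr 1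
    ext y
    exact (heq y (Finset.mem_univ y)).symm

/-- If any two rows of a stochastic matrix have a common entry of size at least `δ`, then the matrix
contracts oscillations by the factor `1 - δ`. -/
theorem IsStochastic.mulVec_sub_le {Q : Matrix S S ℝ} (hQ : IsStochastic Q) {δ : ℝ}
    (hδ : ∀ x y, ∃ z, δ ≤ Q x z ∧ δ ≤ Q y z) {f : S → ℝ} {D : ℝ}
    (hf : ∀ x y, f x - f y ≤ D) (x y : S) :
    Q.mulVec f x - Q.mulVec f y ≤ (1 - δ) * D := by
  classical
  obtain ⟨z, hxz, hyz⟩ := hδ x y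
  have : Nonempty S := ⟨x⟩
  obtain ⟨w, hw⟩ := Finite.exists_min f
  -- Mass `δ` at `z` is removed from both rows and cancels in the difference. The remaining weights
  -- are nonnegative with total `1 - δ`, and `f` lies between its minimum `f w` and `f w + D`.
  have hup : ∑ s, (Q x s - if s = z then δ else 0) * f s
      ≤ ∑ s, (Q x s - if s = z then δ else 0) * (f w + D) := by
    refine Finset.sum_le_sum fun s _ => mul_le_mul_of_nonneg_left (by linarith [hf s w]) ?_
    split_ifs with h
    · subst h; linarith
    · linarith [hQ.nonneg x s]
  have hlo : ∑ s, (Q y s - if s = z then δ else 0) * f w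
      ≤ ∑ s, (Q y s - if s = z then δ else 0) * f s := by
    refine Finset.sum_le_sum fun s _ => mul_le_mul_of_nonneg_left (hw s) ?_
    split_ifs with h
    · subst h; linarith
    · linarith [hQ.nonneg y s]
  rw [← Finset.sum_mul] at hup hlo
  simp only [sub_mul, Finset.sum_sub_distrib, hQ.sum_row, ite_mul, zero_mul, Finset.sum_ite_eq',
    Finset.mem_univ, if_true] at hup hlo
  simp only [Matrix.mulVec, dotProduct]
  linarith

theorem IsStochastic.pow_mulVec_sub_le [DecidableEq S] {Q : Matrix S S ℝ} (hQ : IsStochastic Q) {δ : ℝ}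
    (hδ : ∀ x y, ∃ z, δ ≤ Q x z ∧ δ ≤ Q y z) {f : S → ℝ} {D : ℝ}
    (hf : ∀ x y, f x - f y ≤ D) (k : ℕ) (x y : S) :
    (Q ^ k).mulVec f x - (Q ^ k).mulVec f y ≤ (1 - δ) ^ k * D := by
  induction k generalizing x y with
  | zero => simpa using hf x y
  | succ k ih =>
    have := hQ.mulVec_sub_le hδ ih x y
    rw [Matrix.mulVec_mulVec, ← pow_succ', ← mul_assoc, ← pow_succ'] at this
    exact this

/-- Geometric convergence to stationarity under a pairwise minorization condition. -/
theorem IsStochastic.tvDist_pow_le [DecidableEq S] {Q : Matrix S S ℝ} (hQ : IsStochastic Q) {δ : ℝ}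
    (hδ : ∀ x y, ∃ z, δ ≤ Q x z ∧ δ ≤ Q y z) {π : S → ℝ} (hπ : IsStationaryDist Q π)
    (k : ℕ) (x : S) : tvDist (fun y => (Q ^ k) x y) π ≤ (1 - δ) ^ k := by
  -- The sign of the discrepancy is the test function that attains the total variation norm.
  set f : S → ℝ := fun y => if 0 ≤ (Q ^ k) x y - π y then 1 else -1 with hf
  have hosc : ∀ a b, f a - f b ≤ 2 := fun a b => by
    simp only [hf]
    split_ifs <;> norm_num
  have hstat : ∑ y, π y * (Q ^ k).mulVec f y = ∑ y, π y * f y := by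
    have := Matrix.dotProduct_mulVec π (Q ^ k) f
    rw [(hπ.pow k).2] at this
    exact this
  have hπ1 : ∑ y, π y = 1 := hπ.1.2
  have habs : ∑ y, |(Q ^ k) x y - π y| = (Q ^ k).mulVec f x - ∑ y, π y * f y := by
    simp only [Matrix.mulVec, dotProduct]
    rw [← Finset.sum_sub_distrib]
    refine Finset.sum_congr rfl fun y _ => ?_
    simp only [hf]
    split_ifs with h
    · rw [abs_of_nonneg h]; ring
    · rw [abs_of_neg (not_le.1 h)]; ring
  have hdiff : (Q ^ k).mulVec f x - ∑ y, π y * f y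
      = ∑ y, π y * ((Q ^ k).mulVec f x - (Q ^ k).mulVec f y) := by
    simp only [mul_sub, Finset.sum_sub_distrib, hstat, ← Finset.sum_mul, hπ1, one_mul]
  have hle : ∑ y, π y * ((Q ^ k).mulVec f x - (Q ^ k).mulVec f y)
      ≤ ∑ y, π y * ((1 - δ) ^ k * 2) :=
    Finset.sum_le_sum fun y _ =>
      mul_le_mul_of_nonneg_left (hQ.pow_mulVec_sub_le hδ hosc k x y) (hπ.1.1 y)
  rw [← Finset.sum_mul, hπ1, one_mul] at hle
  rw [tvDist, habs, hdiff]
  linarith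

theorem abs_sub_le_two_mul_tvDist (μ ν : S → ℝ) (y : S) : |μ y - ν y| ≤ 2 * tvDist μ ν := by
  have := Finset.single_le_sum (f := fun x => |μ x - ν x|) (fun x _ => abs_nonneg _)
    (Finset.mem_univ y)
  rw [tvDist]
  linarith

/-- The entries `(Q ^ k) y y` converge to the `y`-mass of every stationary law, and limits are
unique. -/
theorem IsStochastic.isStationaryDist_unique [DecidableEq S] {Q : Matrix S S ℝ} (hQ : IsStochastic Q) {δ : ℝ}
    (hδ0 : 0 < δ) (hδ1 : δ ≤ 1) (hδ : ∀ x y, ∃ z, δ ≤ Q x z ∧ δ ≤ Q y z) {π π' : S → ℝ}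
    (hπ : IsStationaryDist Q π) (hπ' : IsStationaryDist Q π') : π = π' := by
  have key : ∀ {ρ : S → ℝ}, IsStationaryDist Q ρ → ∀ y,
      Tendsto (fun k : ℕ => (Q ^ k) y y) atTop (nhds (ρ y)) := by
    intro ρ hρ y
    have h0 : Tendsto (fun k : ℕ => 2 * (1 - δ) ^ k) atTop (nhds 0) := by
      simpa using (tendsto_pow_atTop_nhds_zero_of_lt_one (r := 1 - δ) (by linarith)
        (by linarith)).const_mul 2
    refine tendsto_iff_dist_tendsto_zero.2 (squeeze_zero (fun _ => dist_nonneg) (fun k => ?_) h0)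
    rw [Real.dist_eq]
    have h2 := abs_sub_le_two_mul_tvDist (fun z => (Q ^ k) y z) ρ y
    linarith [hQ.tvDist_pow_le hδ hρ k y]
  ext y
  exact tendsto_nhds_unique (key hπ y) (key hπ' y)

/-- A mixing time bound from a pairwise minorization of the `w`-step transition matrix. -/
theorem IsStochastic.exists_mem_mixedTimes [DecidableEq S] {P : Matrix S S ℝ} (hP : IsStochastic P) {δ : ℝ}
    (hδ0 : 0 < δ) (hδ1 : δ ≤ 1) {w : ℕ} (hδ : ∀ x y, ∃ z, δ ≤ (P ^ w) x z ∧ δ ≤ (P ^ w) y z)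
    {π : S → ℝ} (hπ : IsStationaryDist P π) :
    ∃ t ∈ mixedTimes P π (1 / 2), (t : ℝ) ≤ 2 * w * δ⁻¹ := by
  -- With `⌈δ⁻¹⌉₊` blocks of `w` steps, `(1 - δ) ^ ⌈δ⁻¹⌉₊ ≤ exp (-1) ≤ 1 / 2`.
  refine ⟨w * ⌈δ⁻¹⌉₊, fun x => ?_, ?_⟩
  · rw [pow_mul]
    refine ((hP.pow w).tvDist_pow_le hδ (hπ.pow w) _ x).trans ?_
    have h1 : 1 - δ ≤ Real.exp (-δ) := by linarith [Real.add_one_le_exp (-δ)]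
    have h2 : 1 ≤ (⌈δ⁻¹⌉₊ : ℝ) * δ := by
      have := mul_le_mul_of_nonneg_right (Nat.le_ceil δ⁻¹) hδ0.le
      rwa [inv_mul_cancel₀ hδ0.ne'] at this
    calc (1 - δ) ^ ⌈δ⁻¹⌉₊ ≤ Real.exp (-δ) ^ ⌈δ⁻¹⌉₊ := pow_le_pow_left₀ (by linarith) h1 _
      _ = Real.exp (⌈δ⁻¹⌉₊ * -δ) := (Real.exp_nat_mul _ _).symm
      _ ≤ Real.exp (-1) := Real.exp_le_exp.2 (by linarith)
      _ ≤ 1 / 2 := by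
        rw [Real.exp_neg, one_div]
        exact inv_anti₀ two_pos (by linarith [Real.add_one_le_exp 1])
  · have h1 : 1 ≤ δ⁻¹ := (one_le_inv₀ hδ0).2 hδ1
    have h2 : (⌈δ⁻¹⌉₊ : ℝ) ≤ 2 * δ⁻¹ := by linarith [Nat.ceil_lt_add_one (inv_nonneg.2 hδ0.le)]
    push_cast
    calc (w : ℝ) * ⌈δ⁻¹⌉₊ ≤ w * (2 * δ⁻¹) := mul_le_mul_of_nonneg_left h2 (Nat.cast_nonneg w)
      _ = _ := by ring

end Stochastic

/-! ### Request words and synchronization of two states -/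

section Network

variable {h : ℕ} {m : Fin h → ℕ+} {n : ℕ}

theorem lruMatrix_isStochastic {p : Fin n → ℝ} (hp : ∀ k, 0 ≤ p k) (hp1 : ∑ k, p k = 1) :
    IsStochastic (lruMatrix m p) where
  nonneg x y := by
    simp only [lruMatrix, Matrix.of_apply]
    refine Finset.sum_nonneg fun k _ => ?_
    split_ifs
    exacts [hp k, le_rfl]
  sum_row x := by
    simp only [lruMatrix, Matrix.of_apply]
    rw [Finset.sum_comm]
    simpa using hp1

theorem le_lruMatrix_lruStep {p : Fin n → ℝ} (hp : ∀ k, 0 ≤ p k) (x : CacheState m n)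
    (k : Fin n) : p k ≤ lruMatrix m p x (lruStep x k) := by
  have := Finset.single_le_sum (f := fun j => if lruStep x j = lruStep x k then p j else 0)
    (fun j _ => by split_ifs; exacts [hp j, le_rfl]) (Finset.mem_univ k)
  simpa [lruMatrix] using this

/-- A word of requests, each of probability at least `c`, is followed with probability at least
`c ^ length`. -/
theorem pow_length_le_lruMatrix_pow {p : Fin n → ℝ} (hp : ∀ k, 0 ≤ p k) (hp1 : ∑ k, p k = 1)
    {c : ℝ} (hc : 0 ≤ c) (l : List (Fin n)) (hl : ∀ k ∈ l, c ≤ p k) (x : CacheState m n) :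
    c ^ l.length ≤ (lruMatrix m p ^ l.length) x (l.foldl lruStep x) := by
  induction l generalizing x with
  | nil => simp
  | cons k l ih =>
    have hP := lruMatrix_isStochastic (m := m) hp hp1
    rw [List.length_cons, pow_succ', pow_succ', List.foldl_cons, Matrix.mul_apply]
    have h1 := mul_le_mul ((hl k (by simp)).trans (le_lruMatrix_lruStep hp x k))
      (ih (fun j hj => hl j (by simp [hj])) (lruStep x k)) (pow_nonneg hc _) (hP.nonneg _ _)
    exact h1.trans (Finset.single_le_sum (f := fun z => lruMatrix m p x z *
      (lruMatrix m p ^ l.length) z (l.foldl lruStep (lruStep x k)))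
      (fun z _ => mul_nonneg (hP.nonneg _ _) ((hP.pow _).nonneg _ _)) (Finset.mem_univ _))

theorem lruStep_apply_of_miss (x : CacheState m n) (k : Fin n) (hk : ∀ s, x s ≠ k) (q : Slot m) :
    lruStep x k q = missFun x k q := by
  have : ¬ ∃ s, x s = k := fun ⟨s, hs⟩ => hk s hs
  simp [lruStep, this]

theorem lruStep_apply_of_hit (x : CacheState m n) (s q : Slot m) :
    lruStep x (x s) q = x (hitSource s q) := by
  have hex : ∃ r, x r = x s := ⟨s, rfl⟩
  have hs : hex.choose = s := x.injective hex.choose_spec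
  simp only [lruStep, hex, dif_pos]
  rw [hs]
  rfl

theorem lruStep_apply_mem (x : CacheState m n) (k : Fin n) (q : Slot m) :
    lruStep x k q = k ∨ ∃ r, lruStep x k q = x r := by
  by_cases hk : ∃ s, x s = k
  · obtain ⟨s, rfl⟩ := hk
    exact .inr ⟨_, lruStep_apply_of_hit x s q⟩
  · rw [lruStep_apply_of_miss x k (fun s hs => hk ⟨s, hs⟩)]
    simp only [missFun]
    split_ifs
    exacts [.inl rfl, .inr ⟨_, rfl⟩, .inr ⟨_, rfl⟩]

/-- Only a request can bring an item in, so unused items of the common supply stay absent from both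
states. -/
theorem foldl_lruStep_ne {l : List (Fin n)} {j : Fin n} (hj : j ∉ l) (x : CacheState m n)
    (hx : ∀ s, x s ≠ j) (q : Slot m) : l.foldl lruStep x q ≠ j := by
  induction l generalizing x with
  | nil => exact hx q
  | cons k l ih =>
    rw [List.mem_cons, not_or] at hj
    refine ih hj.2 _ fun s => ?_
    rcases lruStep_apply_mem x k s with h | ⟨r, h⟩ <;> rw [h]
    exacts [Ne.symm hj.1, hx r]

/-- Requesting an absent item `r + 1` times moves it to the front of the cache of index `r` and
leaves the later caches untouched. -/
theorem foldl_replicate_apply (x : CacheState m n) (k : Fin n) (hk : ∀ s, x s ≠ k) (r : ℕ)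
    (hr : r < h) (q : Slot m) (hq : r ≤ q.1.val) :
    (List.replicate (r + 1) k).foldl lruStep x q =
      if q.1.val = r then (if q.2.val = 0 then k else x q.prev) else x q := by
  induction r generalizing q with
  | zero =>
    change lruStep x k q = _
    rw [lruStep_apply_of_miss x k hk]
    rfl
  | succ r ih =>
    rw [List.replicate_succ', List.foldl_append, List.foldl_cons, List.foldl_nil]
    set y := (List.replicate (r + 1) k).foldl lruStep x with hy
    have hr' : r < h := by omega
    -- After `r + 1` requests the item sits at the front of cache `r`, so the next request is a hit
    -- there.
    let s : Slot m := ⟨⟨r, hr'⟩, ⟨0, (m ⟨r, hr'⟩).pos⟩⟩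
    have hs : y s = k := by
      rw [ih hr' s le_rfl]
      simp [s]
    have hz : ∀ q, lruStep y k q = y (hitSource s q) := fun q => by
      rw [← lruStep_apply_of_hit, hs]
    rw [hz]
    have hlater : ∀ q : Slot m, r + 1 ≤ q.1.val → y q = x q := fun q hq => by
      rw [ih hr' q (by omega), if_neg (by omega)]
    by_cases h1 : q.1.val = r + 1
    · by_cases h2 : q.2.val = 0
      · simp only [hitSource, s, h1, h2, if_true]
        exact hs
      · simp only [hitSource, s, h1, h2, if_true, if_false]
        exact hlater _ (by simpa [Slot.prev] using hq)
    · have h3 : q.1.val ≠ r := by omega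
      simp only [hitSource, s, h1, h3, if_false]
      exact hlater q hq

/-- Two states agree on the caches of index above `i` and on the first `a` slots of cache `i`. -/
def AgreeFrom (i a : ℕ) (x y : CacheState m n) : Prop :=
  ∀ q : Slot m, (i < q.1.val ∨ q.1.val = i ∧ q.2.val < a) → x q = y q

/-- Both states receive `k` at the front of cache `i`, which pushes the agreeing prefix back by one
slot. -/
theorem AgreeFrom.replicate {i a : ℕ} (hi : i < h) {x y : CacheState m n} (hxy : AgreeFrom i a x y)
    {k : Fin n} (hx : ∀ s, x s ≠ k) (hy : ∀ s, y s ≠ k) :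
    AgreeFrom i (a + 1) ((List.replicate (i + 1) k).foldl lruStep x)
      ((List.replicate (i + 1) k).foldl lruStep y) := by
  intro q hq
  have hiq : i ≤ q.1.val := by omega
  rw [foldl_replicate_apply x k hx i hi q hiq, foldl_replicate_apply y k hy i hi q hiq]
  split_ifs with h1 h2
  · rfl
  · refine hxy _ (.inr ⟨h1, ?_⟩)
    simp only [Slot.prev]
    omega
  · exact hxy q (.inl (by omega))

/-- A common supply of absent items lets one request word synchronize a prefix of cache `i`. -/
theorem exists_word_agreeFrom {i : ℕ} (hi : i < h) (a : ℕ) {x y : CacheState m n}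
    (hxy : AgreeFrom i 0 x y) (F : Finset (Fin n)) (hF : a ≤ F.card)
    (hx : ∀ k ∈ F, ∀ s, x s ≠ k) (hy : ∀ k ∈ F, ∀ s, y s ≠ k) :
    ∃ l : List (Fin n), ∃ G ⊆ F, (∀ k ∈ l, k ∈ F) ∧ l.length = (i + 1) * a ∧
      G.card + a = F.card ∧ (∀ k ∈ G, k ∉ l) ∧
      AgreeFrom i a (l.foldl lruStep x) (l.foldl lruStep y) := by
  induction a with
  | zero => exact ⟨[], F, subset_rfl, by simp, by simp, by simp, by simp, hxy⟩
  | succ a ih =>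
    obtain ⟨l, G, hGF, hl, hlen, hcard, hGl, hagree⟩ := ih (by omega)
    obtain ⟨k, hk⟩ : G.Nonempty := Finset.card_pos.1 (by omega)
    refine ⟨l ++ List.replicate (i + 1) k, G.erase k, (Finset.erase_subset _ _).trans hGF,
      ?_, ?_, ?_, ?_, ?_⟩
    · intro j hj
      rcases List.mem_append.1 hj with hj | hj
      · exact hl j hj
      · rw [List.eq_of_mem_replicate hj]
        exact hGF hk
    · rw [List.length_append, List.length_replicate, hlen]
      ring
    · have := Finset.card_erase_add_one hk
      omega
    · intro j hj hjl
      rcases List.mem_append.1 hjl with hjl | hjl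
      · exact hGl j (Finset.mem_of_mem_erase hj) hjl
      · exact Finset.ne_of_mem_erase hj (List.eq_of_mem_replicate hjl)
    · rw [List.foldl_append, List.foldl_append]
      exact hagree.replicate hi (foldl_lruStep_ne (hGl k hk) x (hx k (hGF hk)))
        (foldl_lruStep_ne (hGl k hk) y (hy k (hGF hk)))

/-- The size of the cache of index `i`, zero if there is no such cache. -/
def cacheSize (m : Fin h → ℕ+) (i : ℕ) : ℕ := if hi : i < h then (m ⟨i, hi⟩ : ℕ) else 0

/-- Two states agreeing on all caches of index at least `c` are synchronized by a word over any
large enough set of items absent from both. -/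
theorem exists_word_foldl_eq (c : ℕ) (hc : c ≤ h) {x y : CacheState m n}
    (hxy : ∀ q : Slot m, c ≤ q.1.val → x q = y q) (F : Finset (Fin n))
    (hF : ∑ i ∈ Finset.range c, cacheSize m i ≤ F.card)
    (hx : ∀ k ∈ F, ∀ s, x s ≠ k) (hy : ∀ k ∈ F, ∀ s, y s ≠ k) :
    ∃ l : List (Fin n), (∀ k ∈ l, k ∈ F) ∧
      l.length = ∑ i ∈ Finset.range c, (i + 1) * cacheSize m i ∧
      l.foldl lruStep x = l.foldl lruStep y := by
  induction c generalizing x y F with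
  | zero => exact ⟨[], by simp, by simp, DFunLike.ext _ _ fun q => hxy q (Nat.zero_le _)⟩
  | succ c ih =>
    have hc' : c < h := hc
    rw [Finset.sum_range_succ] at hF
    obtain ⟨l, G, hGF, hl, hlen, hcard, hGl, hagree⟩ :=
      exists_word_agreeFrom (x := x) (y := y) hc' (cacheSize m c)
        (fun q hq => hxy q (by omega)) F (by omega) hx hy
    have hsync : ∀ q : Slot m, c ≤ q.1.val → l.foldl lruStep x q = l.foldl lruStep y q := by
      intro q hq
      refine hagree q ?_
      rcases hq.lt_or_eq with hlt | heq
      · exact .inl hlt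
      · refine .inr ⟨heq.symm, ?_⟩
        have e : (⟨c, hc'⟩ : Fin h) = q.1 := Fin.ext heq
        rw [cacheSize, dif_pos hc', e]
        exact q.2.isLt
    -- The items of `F` left unused, `G`, supply the earlier caches.
    obtain ⟨l', hl', hlen', heq⟩ := ih hc'.le hsync G (by omega)
      (fun k hk => foldl_lruStep_ne (hGl k hk) x (hx k (hGF hk)))
      (fun k hk => foldl_lruStep_ne (hGl k hk) y (hy k (hGF hk)))
    refine ⟨l ++ l', fun k hk => ?_, ?_, ?_⟩
    · rcases List.mem_append.1 hk with hk | hk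
      exacts [hl k hk, hGF (hl' k hk)]
    · rw [List.length_append, hlen, hlen', Finset.sum_range_succ, add_comm]
    · rw [List.foldl_append, List.foldl_append, heq]

theorem sum_range_cacheSize (m : Fin h → ℕ+) :
    ∑ i ∈ Finset.range h, cacheSize m i = totalSize m := by
  simp [Finset.sum_range, cacheSize, totalSize]

theorem sum_range_mul_cacheSize (m : Fin h → ℕ+) :
    ∑ i ∈ Finset.range h, (i + 1) * cacheSize m i = weightedSize m := by
  simp [Finset.sum_range, cacheSize, weightedSize]

theorem card_slot (m : Fin h → ℕ+) : Fintype.card (Slot m) = totalSize m := by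
  simp [Slot, totalSize]

/-- Any two states are synchronized by a word of length `weightedSize m` that only requests items
among the first `3 * totalSize m`. -/
theorem exists_sync_word (hn : 3 * totalSize m ≤ n) (x y : CacheState m n) :
    ∃ l : List (Fin n), (∀ k ∈ l, k.val < 3 * totalSize m) ∧ l.length = weightedSize m ∧
      l.foldl lruStep x = l.foldl lruStep y := by
  classical
  let A : Finset (Fin n) := Finset.univ.map (Fin.castLEEmb hn)
  let R : Finset (Fin n) := Finset.univ.map x ∪ Finset.univ.map y
  have hA : A.card = 3 * totalSize m := by simp [A]
  have hR : R.card ≤ 2 * totalSize m := by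
    refine (Finset.card_union_le _ _).trans ?_
    rw [Finset.card_map, Finset.card_map, Finset.card_univ, card_slot]
    omega
  -- The two states hold at most `2 * totalSize m` items, which explains the factor 3.
  have hcard : totalSize m ≤ (A \ R).card := by
    have := Finset.le_card_sdiff R A
    omega
  -- At `c = h` the agreement hypothesis is vacuous.
  obtain ⟨l, hl, hlen, heq⟩ := exists_word_foldl_eq h le_rfl (x := x) (y := y)
    (fun q hq => absurd q.1.isLt (by omega)) (A \ R) (by rwa [sum_range_cacheSize])
    (fun k hk s hs => (Finset.mem_sdiff.1 hk).2 (Finset.mem_union_left _ (by simp [← hs])))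
    (fun k hk s hs => (Finset.mem_sdiff.1 hk).2 (Finset.mem_union_right _ (by simp [← hs])))
  refine ⟨l, fun k hk => ?_, by rw [hlen, sum_range_mul_cacheSize], heq⟩
  obtain ⟨j, -, rfl⟩ := Finset.mem_map.1 (Finset.mem_sdiff.1 (hl k hk)).1
  exact j.isLt

theorem nonempty_cacheState (hn : totalSize m ≤ n) : Nonempty (CacheState m n) :=
  Function.Embedding.nonempty_of_card_le (by rwa [card_slot, Fintype.card_fin])

theorem weightedSize_le (m : Fin h → ℕ+) : weightedSize m ≤ h * totalSize m := by
  rw [weightedSize, totalSize, Finset.mul_sum]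
  exact Finset.sum_le_sum fun i _ => Nat.mul_le_mul_right _ i.isLt

theorem le_totalSize (m : Fin h → ℕ+) : h ≤ totalSize m := by
  calc h = ∑ _i : Fin h, 1 := by simp
    _ ≤ totalSize m := Finset.sum_le_sum fun i _ => (m i).pos

theorem weightedSize_le_exponent (hh : 0 < h) (m : Fin h → ℕ+) {α : ℝ} (hα : 0 ≤ α) :
    (weightedSize m : ℝ) ≤
      (4 * (totalSize m : ℝ) + 4 * α - 6) * (weightedSize m : ℝ) + 6 := by
  have hw := weightedSize_le m
  have hm := le_totalSize m
  have hαw : 0 ≤ α * (weightedSize m : ℝ) := mul_nonneg hα (Nat.cast_nonneg _)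
  -- For total size at least 2 the coefficient of `w` is at least 2. For total size 1 it may be
  -- negative, but then `w ≤ 1` and the `+ 6` compensates.
  rcases (by omega : totalSize m = 1 ∨ 2 ≤ totalSize m) with h1 | h2
  · have hh1 : h = 1 := by omega
    have hw1 : weightedSize m ≤ 1 := hw.trans (by rw [h1, mul_one]; exact hh1.le)
    have : (weightedSize m : ℝ) ≤ 1 := by exact_mod_cast hw1
    rw [h1]
    push_cast
    linarith
  · have h2' : (2 : ℝ) ≤ totalSize m := by exact_mod_cast h2
    have := mul_le_mul_of_nonneg_right h2' (Nat.cast_nonneg (α := ℝ) (weightedSize m))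
    linarith [Nat.cast_nonneg (α := ℝ) (weightedSize m)]

end Network

/-! ### Lower bound on Zipf probabilities -/

section Zipf

variable {n : ℕ} {α : ℝ}

theorem zipf_nonneg (k : Fin n) : 0 ≤ zipf n α k := by
  unfold zipf
  positivity

theorem sum_zipf (hn : 0 < n) : ∑ k, zipf n α k = 1 := by
  have hpos : 0 < ∑ j : Fin n, 1 / ((j.val : ℝ) + 1) ^ α :=
    Finset.sum_pos (fun j _ => by positivity) ⟨⟨0, hn⟩, Finset.mem_univ _⟩
  simp only [zipf, div_eq_mul_one_div (∑ j : Fin n, 1 / ((j.val : ℝ) + 1) ^ α)⁻¹]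
  rw [← Finset.mul_sum, inv_mul_cancel₀ hpos.ne']

theorem le_zipf (hα : 0 ≤ α) {K : ℕ} (k : Fin n) (hk : k.val < K) :
    ((n : ℝ) * (K : ℝ) ^ α)⁻¹ ≤ zipf n α k := by
  have hn : 0 < n := k.pos
  have hpos : 0 < ∑ j : Fin n, 1 / ((j.val : ℝ) + 1) ^ α :=
    Finset.sum_pos (fun j _ => by positivity) ⟨⟨0, hn⟩, Finset.mem_univ _⟩
  -- Each term of the normalizing sum is at most 1, since `α ≥ 0`.
  have hle : ∑ j : Fin n, 1 / ((j.val : ℝ) + 1) ^ α ≤ n := by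
    calc ∑ j : Fin n, 1 / ((j.val : ℝ) + 1) ^ α ≤ ∑ _j : Fin n, (1 : ℝ) := by
          refine Finset.sum_le_sum fun j _ => ?_
          rw [div_le_one (by positivity)]
          exact Real.one_le_rpow (by linarith [Nat.cast_nonneg (α := ℝ) j.val]) hα
      _ = n := by simp
  have hkK : (k.val : ℝ) + 1 ≤ K := by exact_mod_cast hk
  rw [zipf, div_eq_mul_inv, ← mul_inv]
  refine inv_anti₀ (by positivity) ?_
  exact mul_le_mul hle (Real.rpow_le_rpow (by positivity) hkK hα) (by positivity) (by positivity)

end Zipf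

/-! ### Minorization of the chain and the mixing bound -/

/-- Pairwise minorization of the LRU(m) chain over `weightedSize m` steps under Zipf requests. -/
theorem exists_le_lruMatrix_zipf_pow {h : ℕ} (m : Fin h → ℕ+) {α : ℝ} (hα : 0 ≤ α) {n : ℕ}
    (hn0 : 0 < n) (hn : 3 * totalSize m ≤ n) (x y : CacheState m n) :
    ∃ z, (((n : ℝ) * ((3 * totalSize m : ℕ) : ℝ) ^ α) ^ weightedSize m)⁻¹ ≤
        (lruMatrix m (zipf n α) ^ weightedSize m) x z ∧
      (((n : ℝ) * ((3 * totalSize m : ℕ) : ℝ) ^ α) ^ weightedSize m)⁻¹ ≤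
        (lruMatrix m (zipf n α) ^ weightedSize m) y z := by
  obtain ⟨l, hl, hlen, heq⟩ := exists_sync_word hn x y
  have key := pow_length_le_lruMatrix_pow (m := m) (p := zipf n α) zipf_nonneg (sum_zipf hn0)
    (c := ((n : ℝ) * ((3 * totalSize m : ℕ) : ℝ) ^ α)⁻¹) (by positivity) l
    (fun k hk => le_zipf hα k (hl k hk))
  rw [hlen] at key
  rw [← inv_pow]
  exact ⟨l.foldl lruStep x, key x, by rw [heq]; exact key y⟩

theorem mainTheorem11 (h : ℕ) (hh : 0 < h) (m : Fin h → ℕ+) (α : ℝ) (hα : 0 ≤ α) :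
    (∀ᶠ n : ℕ in atTop, ∃! π : CacheState m n → ℝ, IsStationaryDist (lruMatrix m (zipf n α)) π) ∧
    ∀ π : (n : ℕ) → CacheState m n → ℝ,
      (∀ᶠ n : ℕ in atTop, IsStationaryDist (lruMatrix m (zipf n α)) (π n)) →
        (∀ᶠ n : ℕ in atTop, (mixedTimes (lruMatrix m (zipf n α)) (π n) (1 / 2)).Nonempty) ∧
        (fun n : ℕ => (mixingTime (lruMatrix m (zipf n α)) (π n) (1 / 2) : ℝ)) =O[atTop]
          fun n : ℕ =>
            (n : ℝ) ^ ((4 * (totalSize m : ℝ) + 4 * α - 6) * (weightedSize m : ℝ) + 6) *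
              Real.log n := by
  set w := weightedSize m with hw
  set C : ℝ := ((3 * totalSize m : ℕ) : ℝ) ^ α with hC
  have hm1 : 1 ≤ totalSize m := hh.trans_le (le_totalSize m)
  have hC1 : 1 ≤ C := Real.one_le_rpow (by exact_mod_cast (by omega : 1 ≤ 3 * totalSize m)) hα
  have hbase : ∀ {n : ℕ}, 3 * totalSize m ≤ n → 1 ≤ ((n : ℝ) * C) ^ w := fun {n} hn =>
    one_le_pow₀ (one_le_mul_of_one_le_of_one_le (by exact_mod_cast (by omega : 1 ≤ n)) hC1)
  have hδ0 : ∀ {n : ℕ}, 3 * totalSize m ≤ n → 0 < (((n : ℝ) * C) ^ w)⁻¹ := fun hn =>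
    inv_pos.2 (zero_lt_one.trans_le (hbase hn))
  have hδ1 : ∀ {n : ℕ}, 3 * totalSize m ≤ n → (((n : ℝ) * C) ^ w)⁻¹ ≤ 1 := fun hn =>
    inv_le_one_of_one_le₀ (hbase hn)
  have hstoch : ∀ {n : ℕ}, 3 * totalSize m ≤ n → IsStochastic (lruMatrix m (zipf n α)) :=
    fun hn => lruMatrix_isStochastic zipf_nonneg (sum_zipf (by omega))
  have hmix : ∀ {n : ℕ}, 3 * totalSize m ≤ n → ∀ {ρ : CacheState m n → ℝ},
      IsStationaryDist (lruMatrix m (zipf n α)) ρ →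
      ∃ t ∈ mixedTimes (lruMatrix m (zipf n α)) ρ (1 / 2), (t : ℝ) ≤ 2 * w * ((n : ℝ) * C) ^ w := by
    intro n hn ρ hρ
    simpa only [inv_inv] using (hstoch hn).exists_mem_mixedTimes (hδ0 hn) (hδ1 hn)
      (exists_le_lruMatrix_zipf_pow m hα (by omega) hn) hρ
  refine ⟨?_, fun π hπ => ⟨?_, ?_⟩⟩
  · filter_upwards [eventually_ge_atTop (3 * totalSize m)] with n hn
    have : Nonempty (CacheState m n) := nonempty_cacheState (by omega)
    obtain ⟨ρ, hρ⟩ := (hstoch hn).exists_isStationaryDist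
    exact ⟨ρ, hρ, fun ρ' hρ' => ((hstoch hn).pow w).isStationaryDist_unique (hδ0 hn) (hδ1 hn)
      (exists_le_lruMatrix_zipf_pow m hα (by omega) hn) (hρ'.pow w) (hρ.pow w)⟩
  · filter_upwards [hπ, eventually_ge_atTop (3 * totalSize m)] with n hρ hn
    obtain ⟨t, ht, -⟩ := hmix hn hρ
    exact ⟨t, ht⟩
  · refine IsBigO.of_bound (2 * w * C ^ w) ?_
    filter_upwards [hπ, eventually_ge_atTop (3 * totalSize m)] with n hρ hn
    obtain ⟨t, ht, hle⟩ := hmix hn hρ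
    have hn1 : (1 : ℝ) ≤ n := by exact_mod_cast (by omega : 1 ≤ n)
    -- Here `n ≥ 3 > e`, so the logarithmic factor only enlarges the bound.
    have hlog : 1 ≤ Real.log n := by
      rw [Real.le_log_iff_exp_le (by linarith)]
      have : (3 : ℝ) ≤ n := by exact_mod_cast (by omega : 3 ≤ n)
      linarith [Real.exp_one_lt_d9]
    have hpow : (n : ℝ) ^ w ≤
        (n : ℝ) ^ ((4 * (totalSize m : ℝ) + 4 * α - 6) * (w : ℝ) + 6) := by
      rw [← Real.rpow_natCast]
      exact Real.rpow_le_rpow_of_exponent_le hn1 (weightedSize_le_exponent hh m hα)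
    have hmt : (mixingTime (lruMatrix m (zipf n α)) (π n) (1 / 2) : ℝ) ≤ t := by
      exact_mod_cast Nat.sInf_le ht
    rw [Real.norm_of_nonneg (Nat.cast_nonneg _), Real.norm_of_nonneg (by positivity)]
    calc (mixingTime (lruMatrix m (zipf n α)) (π n) (1 / 2) : ℝ) ≤ 2 * w * ((n : ℝ) * C) ^ w :=
          hmt.trans hle
      _ = 2 * w * C ^ w * ((n : ℝ) ^ w * 1) := by rw [mul_pow]; ring
      _ ≤ _ := by
        refine mul_le_mul_of_nonneg_left ?_ (by positivity)
        exact mul_le_mul hpow hlog zero_le_one (by positivity)
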